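/- Let $A\in\mathbb{C}^{n\times n}$ and $b,x_0\in\mathbb{C}^n$. Let $x_k$ denote the $k$-th GMRES iterate for $Ax=b$ with initial guess $x_0$, that is, $x_k$ minimizes $\|b-Ax\|$ over $x\in x_0+\operatorname{span}\{r_0,Ar_0,\dots,A^{k-1}r_0\}$, and let $r_k:=b-Ax_k$ be its residual; assume $r_0\neq 0$. Here $\|\cdot\|$ is the Euclidean norm of vectors and the induced operator norm (2-norm) of matrices. Partition the spectrum $\sigma(A)$ into pairwise disjoint sets $\Lambda_1,\dots,\Lambda_m$, let $\Gamma_1,\dots,\Gamma_m$ be pairwise non-intersecting rectifiable Jordan curves in $\mathbb{C}$, and let $\varepsilon_1,\dots,\varepsilon_m>0$ be such that for each $j$: - the interior of $\Gamma_j$ contains all the eigenvalues in $\Lambda_j$, and all other eigenvalues of $A$ are exterior to $\Gamma_j$; - $\|(zI-A)^{-1}\|\le 1/\varepsilon_j$ for all $z\in\Gamma_j$. Then, for every $k\ge 0$, $$\frac{\|r_k\|}{\|r_0\|}\ \le\ \min_{\substack{p\in\mathcal{P}_k\\ p(0)=1}}\ \sum_{j=1}^m\left(\frac{\mathcal{L}(\Gamma_j)}{2\pi\varepsilon_j}\,\max_{z\in\Gamma_j}|p(z)|\right),$$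 where $\mathcal{P}_k$ is the set of complex polynomials of degree at most $k$ and $\mathcal{L}(\Gamma_j)$ is the length of $\Gamma_j$; in particular the minimum is attained. -/

import Mathlib

open scoped Matrix.Norms.L2Operator

/-- A Jordan curve in the complex plane: a continuous closed curve, parametrized by `[0, 1]`, with
no self-intersections other than the coincidence of its end points. -/
structure JordanCurve where
  toFun : ℝ → ℂ
  continuousOn' : ContinuousOn toFun (Set.Icc 0 1)
  closed' : toFun 0 = toFun 1
  injOn' : Set.InjOn toFun (Set.Ico 0 1)

namespace JordanCurve

/-- The set of points on the curve. -/
def trace (Γ : JordanCurve) : Set ℂ := Γ.toFun '' Set.Icc 0 1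

/-- The arc length of the curve: the supremum of the lengths of its inscribed polygons. -/
noncomputable def length (Γ : JordanCurve) : ENNReal := eVariationOn Γ.toFun (Set.Icc 0 1)

/-- The curve has finite length. -/
def Rectifiable (Γ : JordanCurve) : Prop := Γ.length ≠ ⊤

/-- The interior of the curve: the points off the curve whose connected component in the
complement of the curve is bounded. -/
def interior (Γ : JordanCurve) : Set ℂ :=
  {z | z ∉ Γ.trace ∧ Bornology.IsBounded (connectedComponentIn Γ.traceᶜ z)}

/-- The exterior of the curve: the points off the curve whose connected component in the
complement of the curve is unbounded. -/
def exterior (Γ : JordanCurve) : Set ℂ :=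
  {z | z ∉ Γ.trace ∧ ¬ Bornology.IsBounded (connectedComponentIn Γ.traceᶜ z)}

/-- The maximum of `|p(z)|` over the points `z` of the curve. -/
noncomputable def maxAbs (Γ : JordanCurve) (p : Polynomial ℂ) : ℝ :=
  sSup ((fun z : ℂ => ‖p.eval z‖) '' Γ.trace)

/-- The supremum in `maxAbs` is a maximum. -/
theorem isGreatest_maxAbs (Γ : JordanCurve) (p : Polynomial ℂ) :
    IsGreatest ((fun z : ℂ => ‖p.eval z‖) '' Γ.trace) (Γ.maxAbs p) := by
  have hc : IsCompact Γ.trace := isCompact_Icc.image_of_continuousOn Γ.continuousOn'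
  have hn : Γ.trace.Nonempty := ⟨Γ.toFun 0, 0, by simp, rfl⟩
  exact (hc.image (p.continuous.norm)).isGreatest_sSup (hn.image _)

end JordanCurve

/-- The residual `b - A x`. -/
noncomputable def gmresResidual {n : ℕ} (A : Matrix (Fin n) (Fin n) ℂ)
    (b x : EuclideanSpace ℂ (Fin n)) : EuclideanSpace ℂ (Fin n) :=
  b - Matrix.toEuclideanCLM (𝕜 := ℂ) A x

/-- The Krylov subspace `span {v, A v, …, A ^ (k - 1) v}`. -/
noncomputable def krylov {n : ℕ} (A : Matrix (Fin n) (Fin n) ℂ)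
    (v : EuclideanSpace ℂ (Fin n)) (k : ℕ) : Submodule ℂ (EuclideanSpace ℂ (Fin n)) :=
  Submodule.span ℂ (Set.range fun i : Fin k => Matrix.toEuclideanCLM (𝕜 := ℂ) (A ^ (i : ℕ)) v)

/-- `x 0, x 1, x 2, …` are GMRES iterates for the system `A x = b` with initial guess `x 0`:
the iterate `x k` minimizes the Euclidean norm of the residual over the affine space
`x 0 + krylov A r₀ k`, where `r₀ = b - A (x 0)`. -/
def IsGMRES {n : ℕ} (A : Matrix (Fin n) (Fin n) ℂ) (b : EuclideanSpace ℂ (Fin n))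
    (x : ℕ → EuclideanSpace ℂ (Fin n)) : Prop :=
  ∀ k : ℕ, x k - x 0 ∈ krylov A (gmresResidual A b (x 0)) k ∧
    ∀ y : EuclideanSpace ℂ (Fin n), y - x 0 ∈ krylov A (gmresResidual A b (x 0)) k →
      ‖gmresResidual A b (x k)‖ ≤ ‖gmresResidual A b y‖

/-- The polynomials of degree at most `k` with value `1` at the origin. -/
def residualPolynomials (k : ℕ) : Set (Polynomial ℂ) :=
  {p | p.natDegree ≤ k ∧ p.eval 0 = 1}

section GmresBound

open Set Filter Topology Complex

/-! ### Continuous logarithms and winding numbers -/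

/-! For `p` with `p(0) = 1` and degree at most `k`, the vector `p(A) r₀` is the residual of a
competitor in the affine Krylov space, so `‖r_k‖ ≤ ‖p(A) r₀‖`. Cauchy's formula writes `p(A)` as the
sum over `j` of `(2πi)⁻¹ ∫ p(z) (z - A)⁻¹ dz` along `Γ_j`, and each term is estimated by length
times maximum (`norm_aeval_apply_le`). The minimum exists because the bound is continuous and
coercive on a closed set in finite dimension.

The Jordan curve theorem is not needed in full: it suffices that `Γ_j` has winding number `0` on its
exterior and one constant `w ≠ 0` on its interior (`exists_windingNumber_interior`). Dividing the
integral by `w` as well restores Cauchy's formula, and `|w| ≥ 1` keeps the estimate. The integrals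
are limits of Riemann–Stieltjes sums, evaluated on generalized eigenvectors, where only the
primitives of `z ^ k` and of powers of `(z - a)⁻¹` enter. -/

theorem exists_continuous_log {X : Type*} [TopologicalSpace X] [SimplyConnectedSpace X]
    [LocallyPathConnectedSpace X] {F : X → ℂ} (hF : Continuous F) (h0 : ∀ x, F x ≠ 0) :
    ∃ g : X → ℂ, Continuous g ∧ ∀ x, exp (g x) = F x := by
  obtain ⟨a⟩ : Nonempty X := inferInstance
  obtain ⟨g, ⟨-, hg⟩, -⟩ := isCoveringMapOn_exp.existsUnique_continuousMap_lifts ⟨F, hF⟩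
    (a₀ := a) (exp_log (h0 a)) (fun x => by simpa using h0 x)
  exact ⟨g, g.continuous, fun x => congrFun hg x⟩

theorem eq_of_exp_eq_one {X : Type*} [TopologicalSpace X] {S : Set X} (hS : IsPreconnected S)
    {h : X → ℂ} (hc : ContinuousOn h S) (h1 : ∀ x ∈ S, exp (h x) = 1) {x y : X}
    (hx : x ∈ S) (hy : y ∈ S) : h x = h y := by
  have : DiscreteTopology (AddSubgroup.zmultiples (2 * (Real.pi : ℂ) * I)) :=
    NormedSpace.discreteTopology_zmultiples _
  refine hS.constant_of_mapsTo (T := (AddSubgroup.zmultiples (2 * (Real.pi : ℂ) * I) : Set ℂ)) ⟨this⟩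
    hc (fun t ht => ?_) hx hy
  obtain ⟨n, hn⟩ := exp_eq_one_iff.1 (h1 t ht)
  exact AddSubgroup.mem_zmultiples_iff.2 ⟨n, by rw [hn, zsmul_eq_mul]⟩

/-- The closed curve `γ`, parametrized by `[0, 1]`, winds `n` times around `a`. -/
def HasWindingNumber (γ : ℝ → ℂ) (a : ℂ) (n : ℤ) : Prop :=
  ∃ l : ℝ → ℂ, ContinuousOn l (Icc 0 1) ∧ (∀ t ∈ Icc (0 : ℝ) 1, exp (l t) = γ t - a) ∧
    l 1 - l 0 = n * (2 * Real.pi * I)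

theorem exists_hasWindingNumber {γ : ℝ → ℂ} (hγ : ContinuousOn γ (Icc 0 1)) (h01 : γ 0 = γ 1)
    {a : ℂ} (ha : a ∉ γ '' Icc 0 1) : ∃ n, HasWindingNumber γ a n := by
  have hne : ∀ t ∈ Icc (0 : ℝ) 1, γ t - a ≠ 0 := fun t ht h =>
    ha ⟨t, ht, sub_eq_zero.1 h⟩
  obtain ⟨g, hg, hge⟩ := exists_continuous_log
    (F := fun t => IccExtend (zero_le_one' ℝ) ((Icc 0 1).domRestrict γ) t - a)
    ((hγ.domRestrict.Icc_extend').sub continuous_const)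
    (fun t => hne _ (projIcc 0 1 zero_le_one t).2)
  have hge' : ∀ t ∈ Icc (0 : ℝ) 1, exp (g t) = γ t - a := fun t ht => by
    rw [hge, IccExtend_of_mem _ _ ht, domRestrict_apply]
  have : exp (g 1) = exp (g 0) := by
    rw [hge' 1 (by simp), hge' 0 (by simp), h01]
  obtain ⟨n, hn⟩ := exp_eq_exp_iff_exists_int.1 this
  exact ⟨n, g, hg.continuousOn, hge', by rw [hn]; ring⟩

/-- The quotient `(γ - a') / (γ - a)` stays in the unit disc around `1`, so its principal logarithm
is a correction to `l` that takes equal values at both ends. -/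
theorem HasWindingNumber.of_norm_lt {γ : ℝ → ℂ} (hγ : ContinuousOn γ (Icc 0 1)) (h01 : γ 0 = γ 1)
    {a a' : ℂ} {n : ℤ} (h : HasWindingNumber γ a n)
    (hlt : ∀ t ∈ Icc (0 : ℝ) 1, ‖a' - a‖ < ‖γ t - a‖) : HasWindingNumber γ a' n := by
  obtain ⟨l, hl, hle, hl1⟩ := h
  have hne : ∀ t ∈ Icc (0 : ℝ) 1, γ t - a ≠ 0 := fun t ht =>
    norm_pos_iff.1 ((norm_nonneg _).trans_lt (hlt t ht))
  have hs : ∀ t ∈ Icc (0 : ℝ) 1, 1 + (-(a' - a)) / (γ t - a) ∈ slitPlane := fun t ht => by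
    refine mem_slitPlane_of_norm_lt_one ?_
    rw [norm_div, norm_neg, div_lt_one (norm_pos_iff.2 (hne t ht))]
    exact hlt t ht
  refine ⟨fun t => l t + log (1 + (-(a' - a)) / (γ t - a)), hl.add
    (ContinuousOn.clog (continuousOn_const.add (continuousOn_const.div
      (hγ.sub continuousOn_const) hne)) hs), fun t ht => ?_, ?_⟩
  · have := hne t ht
    rw [exp_add, hle t ht, exp_log (slitPlane_ne_zero (hs t ht))]
    field_simp
    ring
  · simp only [h01, ← hl1]
    ring

theorem hasWindingNumber_zero {γ : ℝ → ℂ} (hγ : ContinuousOn γ (Icc 0 1)) (h01 : γ 0 = γ 1)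
    {a : ℂ} (hlt : ∀ t ∈ Icc (0 : ℝ) 1, ‖γ t‖ < ‖a‖) : HasWindingNumber γ a 0 := by
  have ha : a ≠ 0 := norm_pos_iff.1 ((norm_nonneg _).trans_lt (hlt 0 (by simp)))
  have hs : ∀ t ∈ Icc (0 : ℝ) 1, 1 + (-γ t) / a ∈ slitPlane := fun t ht => by
    refine mem_slitPlane_of_norm_lt_one ?_
    rw [norm_div, norm_neg, div_lt_one (norm_pos_iff.2 ha)]
    exact hlt t ht
  refine ⟨fun t => log (-a) + log (1 + (-γ t) / a), continuousOn_const.add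
    (ContinuousOn.clog (continuousOn_const.add (hγ.neg.div_const a)) hs), fun t ht => ?_, ?_⟩
  · rw [exp_add, exp_log (neg_ne_zero.2 ha), exp_log (slitPlane_ne_zero (hs t ht))]
    field_simp
    ring
  · simp [h01]

theorem HasWindingNumber.unique {γ : ℝ → ℂ} {a : ℂ} {n n' : ℤ} (h : HasWindingNumber γ a n)
    (h' : HasWindingNumber γ a n') : n = n' := by
  obtain ⟨l, hl, hle, hl1⟩ := h
  obtain ⟨l', hl', hle', hl1'⟩ := h'
  have hne : ∀ t ∈ Icc (0 : ℝ) 1, γ t - a ≠ 0 := fun t ht => by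
    rw [← hle t ht]; exact exp_ne_zero _
  have := eq_of_exp_eq_one (isPreconnected_Icc) (hl.sub hl')
    (fun t ht => by
      simp only [Pi.sub_apply, exp_sub]
      rw [hle t ht, hle' t ht, div_self (hne t ht)])
    (right_mem_Icc.2 (zero_le_one' ℝ)) (left_mem_Icc.2 (zero_le_one' ℝ))
  have h2 : (n : ℂ) * (2 * Real.pi * I) = n' * (2 * Real.pi * I) := by
    rw [← hl1, ← hl1']
    simp only [Pi.sub_apply] at this
    linear_combination this
  exact_mod_cast mul_right_cancel₀ two_pi_I_ne_zero h2

theorem HasWindingNumber.of_isPreconnected {γ : ℝ → ℂ} (hγ : ContinuousOn γ (Icc 0 1))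
    (h01 : γ 0 = γ 1) {S : Set ℂ} (hS : IsPreconnected S) (hSγ : S ⊆ (γ '' Icc 0 1)ᶜ)
    {a a' : ℂ} (ha : a ∈ S) (ha' : a' ∈ S) {n : ℤ} (h : HasWindingNumber γ a n) :
    HasWindingNumber γ a' n := by
  classical
  -- The default `0` is never met off the curve, where a winding number exists.
  let w : ℂ → ℤ := fun z => if hz : ∃ n, HasWindingNumber γ z n then hz.choose else 0
  have hw : ∀ z ∈ (γ '' Icc 0 1)ᶜ, HasWindingNumber γ z (w z) := fun z hz => by
    have := exists_hasWindingNumber hγ h01 hz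
    simp only [w, dif_pos this]
    exact this.choose_spec
  have hcont : ContinuousOn w S := by
    intro z hz
    have hK : IsCompact (γ '' Icc 0 1) := isCompact_Icc.image_of_continuousOn hγ
    refine (ContinuousAt.continuousWithinAt ?_)
    obtain ⟨r, hr, hball⟩ := Metric.isOpen_iff.1 hK.isClosed.isOpen_compl z (hSγ hz)
    have : w =ᶠ[𝓝 z] fun _ => w z := by
      filter_upwards [Metric.ball_mem_nhds z hr] with y hy
      refine (hw y (hball hy)).unique ((hw z (hSγ hz)).of_norm_lt hγ h01 fun t ht => ?_)
      rw [← dist_eq_norm, ← dist_eq_norm]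
      refine (Metric.mem_ball.1 hy).trans_le ?_
      by_contra! hlt
      exact hball (Metric.mem_ball.2 hlt) ⟨t, ht, rfl⟩
    exact continuousAt_const.congr this.symm
  have : w a = w a' := hS.constant hcont ha ha'
  rw [h.unique (hw a (hSγ ha)), this]
  exact hw a' (hSγ ha')

/-- `F` would have a logarithm on the whole plane. Around a large circle this logarithm returns to
its value, while a logarithm of `(z - a) ^ n` gains `2πi n`. -/
theorem not_continuous_eq_zpow_off_isBounded {F : ℂ → ℂ} (hF : Continuous F) (h0 : ∀ z, F z ≠ 0)
    {U : Set ℂ} (hU : Bornology.IsBounded U) {a : ℂ} {n : ℤ} (hn : n ≠ 0)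
    (hFU : ∀ z ∉ U, F z = (z - a) ^ n) : False := by
  obtain ⟨g, hg, hge⟩ := exists_continuous_log hF h0
  obtain ⟨R, hR, hUR⟩ := hU.subset_ball_lt 0 a
  have hc : Continuous fun θ : ℝ => g (a + R * exp (θ * I)) - n * (Real.log R + θ * I) := by
    fun_prop
  have h1 : ∀ θ : ℝ, exp (g (a + R * exp (θ * I)) - n * (Real.log R + θ * I)) = 1 := fun θ => by
    rw [exp_sub, hge, hFU, exp_int_mul, exp_add, ← ofReal_exp, Real.exp_log hR, add_sub_cancel_left]
    · refine div_self (zpow_ne_zero _ (mul_ne_zero ?_ (exp_ne_zero _)))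
      exact_mod_cast hR.ne'
    · intro h
      have := Metric.mem_ball.1 (hUR h)
      rw [dist_eq_norm, add_sub_cancel_left, norm_mul, norm_exp_ofReal_mul_I, norm_real,
        Real.norm_of_nonneg hR.le] at this
      linarith
  have := eq_of_exp_eq_one isPreconnected_univ hc.continuousOn (fun θ _ => h1 θ)
    (mem_univ (0 : ℝ)) (mem_univ (2 * Real.pi))
  simp only [ofReal_zero, zero_mul, exp_zero, ofReal_mul, ofReal_ofNat, exp_two_pi_mul_I] at this
  have h2 : (n : ℂ) * (2 * Real.pi * I) = 0 := by linear_combination this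
  exact hn (by exact_mod_cast (mul_eq_zero.1 h2).resolve_right two_pi_I_ne_zero)

/-- Extend `g` to the plane by Tietze. Gluing `exp g * P` on `U` to `(z - a) ^ n` off `U` gives a
continuous function without zeros, which the preceding lemma forbids. -/
theorem not_continuousOn_log_of_frontier_subset {K U : Set ℂ} (hK : IsClosed K) (hU : IsOpen U)
    (hUb : Bornology.IsBounded U) (hUK : frontier U ⊆ K) {a : ℂ} (ha : a ∈ U) {n : ℤ}
    (hn : n ≠ 0) {P g : ℂ → ℂ} (hP : ContinuousOn P (closure U)) (hP0 : ∀ z ∈ U, P z ≠ 0)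
    (hg : ContinuousOn g K) (h : ∀ z ∈ K, (z - a) ^ n = exp (g z) * P z) : False := by
  classical
  obtain ⟨G, hG⟩ := ContinuousMap.exists_restrict_eq hK ⟨K.domRestrict g, hg.domRestrict⟩
  have hGg : ∀ z ∈ K, G z = g z := fun z hz => congrArg (fun f : C(K, ℂ) => f ⟨z, hz⟩) hG
  refine not_continuous_eq_zpow_off_isBounded (a := a) (n := n)
    (F := U.piecewise (fun z => exp (G z) * P z) (fun z => (z - a) ^ n)) ?_ (fun z => ?_)
    hUb hn (fun z hz => piecewise_eq_of_notMem _ _ _ hz)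
  · refine continuous_piecewise (fun z hz => ?_) ?_ ?_
    · rw [h z (hUK hz), hGg z (hUK hz)]
    · exact (G.continuous.cexp.continuousOn).mul hP
    · rw [hU.isClosed_compl.closure_eq]
      refine ContinuousOn.zpow₀ (by fun_prop) n fun z hz => Or.inl ?_
      rintro h0
      exact hz (sub_eq_zero.1 h0 ▸ ha)
  · by_cases hz : z ∈ U
    · rw [piecewise_eq_of_mem _ _ _ hz]
      exact mul_ne_zero (exp_ne_zero _) (hP0 z hz)
    · rw [piecewise_eq_of_notMem _ _ _ hz]
      refine zpow_ne_zero _ fun h0 => hz (sub_eq_zero.1 h0 ▸ ha)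

theorem frontier_connectedComponentIn_compl_subset {K : Set ℂ} (hK : IsClosed K) (a : ℂ) :
    frontier (connectedComponentIn Kᶜ a) ⊆ K := by
  intro z hz
  by_contra hzK
  have hopen : ∀ w, IsOpen (connectedComponentIn Kᶜ w) := fun w =>
    hK.isOpen_compl.connectedComponentIn
  have hzV : z ∈ connectedComponentIn Kᶜ z := mem_connectedComponentIn hzK
  obtain ⟨y, hy, hy'⟩ := mem_closure_iff.1 (frontier_subset_closure hz) _ (hopen z) hzV
  have : connectedComponentIn Kᶜ z = connectedComponentIn Kᶜ a :=
    (connectedComponentIn_eq hy).trans (connectedComponentIn_eq hy').symm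
  rw [this] at hzV
  exact (hopen a).inter_frontier_eq.subset ⟨hzV, hz⟩

/-! ### Winding numbers of Jordan curves -/

namespace JordanCurve

variable (Γ : JordanCurve)

theorem isCompact_trace : IsCompact Γ.trace := isCompact_Icc.image_of_continuousOn Γ.continuousOn'

theorem mem_trace {t : ℝ} (ht : t ∈ Icc (0 : ℝ) 1) : Γ.toFun t ∈ Γ.trace := ⟨t, ht, rfl⟩

theorem eq_or_of_toFun_eq {s t : ℝ} (hs : s ∈ Icc (0 : ℝ) 1) (ht : t ∈ Icc (0 : ℝ) 1)
    (h : Γ.toFun s = Γ.toFun t) : s = t ∨ s = 0 ∧ t = 1 ∨ s = 1 ∧ t = 0 := by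
  have h0 : (0 : ℝ) ∈ Ico (0 : ℝ) 1 := by simp
  rcases hs.2.lt_or_eq with h1 | rfl
  · rcases ht.2.lt_or_eq with h2 | rfl
    · exact Or.inl (Γ.injOn' ⟨hs.1, h1⟩ ⟨ht.1, h2⟩ h)
    · exact Or.inr (Or.inl ⟨Γ.injOn' ⟨hs.1, h1⟩ h0 (h.trans Γ.closed'.symm), rfl⟩)
  · rcases ht.2.lt_or_eq with h2 | rfl
    · exact Or.inr (Or.inr ⟨rfl, Γ.injOn' ⟨ht.1, h2⟩ h0 (h.symm.trans Γ.closed'.symm)⟩)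
    · exact Or.inl rfl

/-- Only the end points of `[0, 1]` are identified by the parametrization, which is a quotient map
onto the trace by compactness. -/
theorem exists_continuousOn_trace {l : ℝ → ℂ} (hl : ContinuousOn l (Icc 0 1)) (h01 : l 0 = l 1) :
    ∃ g : ℂ → ℂ, ContinuousOn g Γ.trace ∧ ∀ t ∈ Icc (0 : ℝ) 1, g (Γ.toFun t) = l t := by
  classical
  let g : ℂ → ℂ := fun z => if hz : z ∈ Γ.trace then l hz.choose else 0
  have hg : ∀ t ∈ Icc (0 : ℝ) 1, g (Γ.toFun t) = l t := fun t ht => by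
    have hz := Γ.mem_trace ht
    simp only [g, dif_pos hz]
    rcases Γ.eq_or_of_toFun_eq hz.choose_spec.1 ht hz.choose_spec.2 with h | ⟨h, h'⟩ | ⟨h, h'⟩
    · rw [h]
    · rw [h, h', h01]
    · rw [h, h', h01]
  refine ⟨g, ?_, hg⟩
  let π : Icc (0 : ℝ) 1 → Γ.trace := fun t => ⟨Γ.toFun t, Γ.mem_trace t.2⟩
  have hπ : Continuous π := Γ.continuousOn'.domRestrict.subtype_mk _
  have hq : IsQuotientMap π := hπ.isClosedMap.isQuotientMap hπ fun ⟨z, t, ht, hz⟩ =>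
    ⟨⟨t, ht⟩, Subtype.ext hz⟩
  rw [continuousOn_iff_continuous_domRestrict, hq.continuous_iff]
  convert hl.domRestrict using 1
  ext t
  exact hg t t.2

theorem exists_hasWindingNumber {a : ℂ} (ha : a ∉ Γ.trace) : ∃ n, HasWindingNumber Γ.toFun a n :=
  _root_.exists_hasWindingNumber Γ.continuousOn' Γ.closed' ha

theorem hasWindingNumber_of_mem_exterior {a : ℂ} (ha : a ∈ Γ.exterior) :
    HasWindingNumber Γ.toFun a 0 := by
  obtain ⟨R, hR⟩ := Γ.isCompact_trace.isBounded.exists_norm_le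
  obtain ⟨z, hz, hzR⟩ : ∃ z ∈ connectedComponentIn Γ.traceᶜ a, R < ‖z‖ := by
    by_contra! h
    exact ha.2 (isBounded_iff_forall_norm_le.2 ⟨R, h⟩)
  exact (hasWindingNumber_zero Γ.continuousOn' Γ.closed' fun t ht =>
    (hR _ (Γ.mem_trace ht)).trans_lt hzR).of_isPreconnected Γ.continuousOn' Γ.closed'
    isPreconnected_connectedComponentIn (connectedComponentIn_subset _ _) hz
    (mem_connectedComponentIn ha.1)

/-- With winding number `0`, `z - a` would have a continuous logarithm on the trace, which contains
the frontier of the bounded component of `a`. -/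
theorem windingNumber_ne_zero_of_mem_interior {a : ℂ} (ha : a ∈ Γ.interior) {n : ℤ}
    (h : HasWindingNumber Γ.toFun a n) : n ≠ 0 := by
  rintro rfl
  obtain ⟨l, hl, hle, hl1⟩ := h
  obtain ⟨g, hg, hgl⟩ := Γ.exists_continuousOn_trace hl
    (by rw [Int.cast_zero, zero_mul] at hl1; exact (sub_eq_zero.1 hl1).symm)
  refine not_continuousOn_log_of_frontier_subset Γ.isCompact_trace.isClosed
    Γ.isCompact_trace.isClosed.isOpen_compl.connectedComponentIn ha.2
    (frontier_connectedComponentIn_compl_subset Γ.isCompact_trace.isClosed a)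
    (mem_connectedComponentIn ha.1) (one_ne_zero (α := ℤ)) (P := fun _ => 1) continuousOn_const
    (fun _ _ => one_ne_zero) hg ?_
  rintro _ ⟨t, ht, rfl⟩
  simp [hgl t ht, hle t ht]

/-- Within one component the winding number is constant. Two different bounded components cannot
occur: `(z - a) ^ n' / (z - a') ^ n` has total winding `n' * n - n * n' = 0`, hence a logarithm on
the trace, and `(z - a') ^ n` has no zero or pole on the component of `a`. -/
theorem windingNumber_eq_of_mem_interior {a a' : ℂ} (ha : a ∈ Γ.interior) (ha' : a' ∈ Γ.interior)
    {n n' : ℤ} (h : HasWindingNumber Γ.toFun a n) (h' : HasWindingNumber Γ.toFun a' n') :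
    n = n' := by
  have hcl := Γ.isCompact_trace.isClosed
  by_cases hmem : a' ∈ connectedComponentIn Γ.traceᶜ a
  · exact (h.of_isPreconnected Γ.continuousOn' Γ.closed' isPreconnected_connectedComponentIn
      (connectedComponentIn_subset _ _) (mem_connectedComponentIn ha.1) hmem).unique h'
  exfalso
  have hn' := Γ.windingNumber_ne_zero_of_mem_interior ha' h'
  obtain ⟨l, hl, hle, hl1⟩ := h
  obtain ⟨l', hl', hle', hl1'⟩ := h'
  obtain ⟨g, hg, hgl⟩ := Γ.exists_continuousOn_trace (l := fun t => n' * l t - n * l' t)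
    ((continuousOn_const.mul hl).sub (continuousOn_const.mul hl'))
    (by linear_combination (n : ℂ) * hl1' - (n' : ℂ) * hl1)
  have hopen := hcl.isOpen_compl.connectedComponentIn (x := a)
  have hfr := frontier_connectedComponentIn_compl_subset hcl a
  have hcU : ∀ z ∈ closure (connectedComponentIn Γ.traceᶜ a), z - a' ≠ 0 := fun z hz h0 => by
    rw [sub_eq_zero.1 h0] at hz
    refine ha'.1 (hfr ⟨hz, ?_⟩)
    rwa [hopen.interior_eq]
  refine not_continuousOn_log_of_frontier_subset hcl hopen ha.2 hfr
    (mem_connectedComponentIn ha.1) hn' (P := fun z => (z - a') ^ n)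
    (ContinuousOn.zpow₀ (by fun_prop) n fun z hz => Or.inl (hcU z hz))
    (fun z hz => zpow_ne_zero _ (hcU z (subset_closure hz))) hg ?_
  rintro _ ⟨t, ht, rfl⟩
  rw [hgl t ht, ← hle t ht, ← hle' t ht, ← exp_int_mul, ← exp_int_mul, ← exp_add]
  congr 1
  ring

/-- A Jordan curve winds around all points of its interior equally often, and at least once. -/
theorem exists_windingNumber_interior :
    ∃ w : ℤ, w ≠ 0 ∧ ∀ a ∈ Γ.interior, HasWindingNumber Γ.toFun a w := by
  rcases Γ.interior.eq_empty_or_nonempty with h | ⟨a, ha⟩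
  · exact ⟨1, one_ne_zero, by simp [h]⟩
  · obtain ⟨n, hn⟩ := Γ.exists_hasWindingNumber ha.1
    refine ⟨n, Γ.windingNumber_ne_zero_of_mem_interior ha hn, fun a' ha' => ?_⟩
    obtain ⟨n', hn'⟩ := Γ.exists_hasWindingNumber ha'.1
    rwa [Γ.windingNumber_eq_of_mem_interior ha ha' hn hn']

end JordanCurve

/-! ### Riemann–Stieltjes sums along rectifiable curves -/

/-- The Riemann–Stieltjes sum of `∫ f dγ` for the division of `[0, 1]` into `N` equal parts. -/
noncomputable def stieltjesSum {E : Type*} [AddCommGroup E] [Module ℂ E] (γ : ℝ → ℂ) (f : ℂ → E)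
    (N : ℕ) : E :=
  ∑ i ∈ Finset.range N, (γ ((i + 1 : ℕ) / N) - γ (i / N)) • f (γ (i / N))

theorem natCast_div_mem_Icc {i N : ℕ} (h : i ≤ N) : (i / N : ℝ) ∈ Icc (0 : ℝ) 1 :=
  ⟨by positivity, div_le_one_of_le₀ (by exact_mod_cast h) (by positivity)⟩

theorem sum_norm_sub_le_eVariationOn {γ : ℝ → ℂ} (hγ : eVariationOn γ (Icc 0 1) ≠ ⊤) (N : ℕ) :
    ∑ i ∈ Finset.range N, ‖γ ((i + 1 : ℕ) / N) - γ (i / N)‖ ≤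
      (eVariationOn γ (Icc 0 1)).toReal := by
  have h := eVariationOn.sum_le_of_monotoneOn_Iic (f := γ) (s := Icc (0 : ℝ) 1) (n := N)
    (u := fun i => (i : ℝ) / N) (fun i _ j _ hij =>
      div_le_div_of_nonneg_right (Nat.cast_le.2 hij) (Nat.cast_nonneg _))
    (fun i hi => natCast_div_mem_Icc hi)
  rw [← ENNReal.ofReal_le_iff_le_toReal hγ, ENNReal.ofReal_sum_of_nonneg fun _ _ => norm_nonneg _]
  refine le_trans (le_of_eq (Finset.sum_congr rfl fun i _ => ?_)) h
  rw [edist_dist, dist_eq_norm]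

theorem norm_stieltjesSum_le {E : Type*} [SeminormedAddCommGroup E] [NormedSpace ℂ E] {γ : ℝ → ℂ}
    (hγ : eVariationOn γ (Icc 0 1) ≠ ⊤) {f : ℂ → E} {C : ℝ} (hC : 0 ≤ C)
    (hf : ∀ t ∈ Icc (0 : ℝ) 1, ‖f (γ t)‖ ≤ C) (N : ℕ) :
    ‖stieltjesSum γ f N‖ ≤ (eVariationOn γ (Icc 0 1)).toReal * C := by
  refine (norm_sum_le _ _).trans (le_trans ?_
    (mul_le_mul_of_nonneg_right (sum_norm_sub_le_eVariationOn hγ N) hC))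
  rw [Finset.sum_mul]
  refine Finset.sum_le_sum fun i hi => ?_
  rw [norm_smul]
  gcongr
  exact hf _ (natCast_div_mem_Icc (Finset.mem_range.1 hi).le)

/-- A Lebesgue number makes the local estimate uniform for fine divisions. The increments of `G`
telescope, and the errors add up to at most `η` times the length. -/
theorem tendsto_stieltjesSum_of_local {γ : ℝ → ℂ} (hγ : eVariationOn γ (Icc 0 1) ≠ ⊤)
    {f : ℂ → ℂ} {G : ℝ → ℂ}
    (h : ∀ t ∈ Icc (0 : ℝ) 1, ∀ η > 0, ∀ᶠ q in 𝓝[Icc 0 1] t ×ˢ 𝓝[Icc 0 1] t,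
      ‖G q.1 - G q.2 - (γ q.1 - γ q.2) * f (γ q.2)‖ ≤ η * ‖γ q.1 - γ q.2‖) :
    Tendsto (stieltjesSum γ f) atTop (𝓝 (G 1 - G 0)) := by
  set L := (eVariationOn γ (Icc 0 1)).toReal
  have hL : 0 ≤ L := ENNReal.toReal_nonneg
  rw [Metric.tendsto_atTop]
  intro e he
  -- The `+ 1` makes the final inequality strict and allows `L = 0`.
  have hη : 0 < e / (L + 1) := by positivity
  have hball : ∀ t : Icc (0 : ℝ) 1, ∃ r > 0, ∀ s ∈ Metric.ball (t : ℝ) r ∩ Icc 0 1,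
      ∀ s' ∈ Metric.ball (t : ℝ) r ∩ Icc 0 1,
      ‖G s - G s' - (γ s - γ s') * f (γ s')‖ ≤ e / (L + 1) * ‖γ s - γ s'‖ := fun t => by
    obtain ⟨U, hU, V, hV, hUV⟩ := mem_prod_iff.1 (h t t.2 _ hη)
    obtain ⟨r, hr, hrU⟩ := Metric.mem_nhdsWithin_iff.1 (inter_mem hU hV)
    exact ⟨r, hr, fun s hs s' hs' => hUV (mk_mem_prod (hrU hs).1 (hrU hs').2)⟩
  choose r hr hrb using hball
  obtain ⟨δ, hδ, hleb⟩ := lebesgue_number_lemma_of_metric (isCompact_Icc (a := (0 : ℝ)) (b := 1))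
    (c := fun t : Icc (0 : ℝ) 1 => Metric.ball (t : ℝ) (r t)) (fun _ => Metric.isOpen_ball)
    (fun t ht => mem_iUnion.2 ⟨⟨t, ht⟩, Metric.mem_ball_self (hr _)⟩)
  obtain ⟨N₀, hN₀⟩ := exists_nat_one_div_lt hδ
  refine ⟨N₀ + 1, fun N hN => ?_⟩
  have hNpos : 0 < N := (Nat.succ_pos _).trans_le hN
  have hNδ : (1 : ℝ) / N < δ := lt_of_le_of_lt
    (one_div_le_one_div_of_le (by positivity) (by exact_mod_cast hN)) hN₀
  have htel : G 1 - G 0 = ∑ i ∈ Finset.range N, (G ((i + 1 : ℕ) / N) - G (i / N)) := by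
    rw [Finset.sum_range_sub (fun i : ℕ => G ((i : ℝ) / N))]
    simp [hNpos.ne']
  rw [dist_comm, dist_eq_norm, htel, stieltjesSum, ← Finset.sum_sub_distrib]
  refine (norm_sum_le _ _).trans_lt ?_
  have hbound : ∀ i ∈ Finset.range N,
      ‖G ((i + 1 : ℕ) / N) - G (i / N) - (γ ((i + 1 : ℕ) / N) - γ (i / N)) • f (γ (i / N))‖ ≤
        e / (L + 1) * ‖γ ((i + 1 : ℕ) / N) - γ (i / N)‖ := fun i hi => by
    have hi' := Finset.mem_range.1 hi
    have hmem := natCast_div_mem_Icc hi'.le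
    have hmem' := natCast_div_mem_Icc (Nat.succ_le_of_lt hi')
    obtain ⟨t, ht⟩ := hleb _ hmem
    refine hrb t _ ⟨ht ?_, hmem'⟩ _ ⟨ht (Metric.mem_ball_self hδ), hmem⟩
    rw [Metric.mem_ball, Real.dist_eq, ← sub_div, Nat.cast_succ, add_sub_cancel_left,
      abs_of_nonneg (by positivity)]
    exact hNδ
  calc _ ≤ ∑ i ∈ Finset.range N, e / (L + 1) * ‖γ ((i + 1 : ℕ) / N) - γ (i / N)‖ :=
        Finset.sum_le_sum hbound
    _ ≤ e / (L + 1) * L := by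
        rw [← Finset.mul_sum]
        gcongr
        exact sum_norm_sub_le_eVariationOn hγ N
    _ < e := by
        rw [div_mul_eq_mul_div, div_lt_iff₀ (by positivity)]
        nlinarith

/-- Both points vary, hence the strict derivative. `G` need only agree with `F ∘ γ` near `t`, which
admits local branches of the logarithm. -/
theorem eventually_norm_sub_le_of_hasStrictDerivAt {γ : ℝ → ℂ} {S : Set ℝ}
    (hγ : ContinuousOn γ S) {f F : ℂ → ℂ} {G : ℝ → ℂ} {t : ℝ} (ht : t ∈ S)
    (hF : HasStrictDerivAt F (f (γ t)) (γ t)) (hf : ContinuousAt f (γ t))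
    (hG : ∀ᶠ s in 𝓝[S] t, G s = F (γ s)) {η : ℝ} (hη : 0 < η) :
    ∀ᶠ q in 𝓝[S] t ×ˢ 𝓝[S] t,
      ‖G q.1 - G q.2 - (γ q.1 - γ q.2) * f (γ q.2)‖ ≤ η * ‖γ q.1 - γ q.2‖ := by
  have hγt : Tendsto γ (𝓝[S] t) (𝓝 (γ t)) := hγ t ht
  have h1 := (hasStrictDerivAt_iff_hasStrictFDerivAt.1 hF).isLittleO.def (half_pos hη)
  rw [nhds_prod_eq] at h1
  have h2 := (hγt.prodMap hγt).eventually h1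
  have h3 := (hf.tendsto.comp hγt).eventually (Metric.ball_mem_nhds _ (half_pos hη))
  filter_upwards [h2, hG.prod_mk hG, h3.prod_inr (𝓝[S] t)] with q hq1 hq2 hq3
  rw [hq2.1, hq2.2]
  simp only [Prod.map_fst, Prod.map_snd, ContinuousLinearMap.toSpanSingleton_apply,
    smul_eq_mul] at hq1
  have hq3' : ‖f (γ q.2) - f (γ t)‖ ≤ η / 2 := by
    rw [← dist_eq_norm]
    exact (Metric.mem_ball.1 hq3).le
  calc ‖F (γ q.1) - F (γ q.2) - (γ q.1 - γ q.2) * f (γ q.2)‖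
      = ‖(F (γ q.1) - F (γ q.2) - (γ q.1 - γ q.2) * f (γ t)) -
          (γ q.1 - γ q.2) * (f (γ q.2) - f (γ t))‖ := by congr 1; ring
    _ ≤ η / 2 * ‖γ q.1 - γ q.2‖ + ‖γ q.1 - γ q.2‖ * (η / 2) := by
        refine (norm_sub_le _ _).trans (add_le_add hq1 ?_)
        rw [norm_mul]
        gcongr
    _ = η * ‖γ q.1 - γ q.2‖ := by ring

theorem tendsto_stieltjesSum_of_primitive {γ : ℝ → ℂ} (hc : ContinuousOn γ (Icc 0 1))
    (hγ : eVariationOn γ (Icc 0 1) ≠ ⊤) (h01 : γ 0 = γ 1) {f F : ℂ → ℂ}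
    (hF : ∀ t ∈ Icc (0 : ℝ) 1, HasStrictDerivAt F (f (γ t)) (γ t))
    (hf : ∀ t ∈ Icc (0 : ℝ) 1, ContinuousAt f (γ t)) :
    Tendsto (stieltjesSum γ f) atTop (𝓝 0) := by
  have := tendsto_stieltjesSum_of_local hγ (f := f) (G := fun t => F (γ t)) fun t ht η hη =>
    eventually_norm_sub_le_of_hasStrictDerivAt hc ht (hF t ht) (hf t ht)
      (Eventually.of_forall fun _ => rfl) hη
  simpa [h01] using this

theorem HasWindingNumber.tendsto_stieltjesSum {γ : ℝ → ℂ} (hc : ContinuousOn γ (Icc 0 1))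
    (hγ : eVariationOn γ (Icc 0 1) ≠ ⊤) {a : ℂ} {n : ℤ} (h : HasWindingNumber γ a n) :
    Tendsto (stieltjesSum γ fun z => (z - a)⁻¹) atTop (𝓝 (n * (2 * Real.pi * I))) := by
  obtain ⟨l, hl, hle, hl1⟩ := h
  rw [← hl1]
  refine tendsto_stieltjesSum_of_local hγ fun t ht η hη => ?_
  have hne : γ t - a ≠ 0 := by
    rw [← hle t ht]; exact exp_ne_zero _
  refine eventually_norm_sub_le_of_hasStrictDerivAt (f := fun z => (z - a)⁻¹)
    (F := fun z => log ((z - a) / (γ t - a)) + l t) hc ht ?_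
    ((continuousAt_id.sub continuousAt_const).inv₀ hne) ?_ hη
  · have h1 : HasStrictDerivAt (fun z : ℂ => (z - a) / (γ t - a)) (1 / (γ t - a)) (γ t) :=
      HasStrictDerivAt.div_const ((hasStrictDerivAt_id _).sub_const a) _
    have h2 := (h1.clog (by rw [div_self hne]; exact one_mem_slitPlane)).add_const (l t)
    rw [div_self hne, div_one, one_div] at h2
    exact h2
  -- Near `t` the imaginary part of `l s - l t` is below `π` in absolute value, so the principal
  -- branch recovers `l`.
  · have hball : Metric.ball (l t) Real.pi ∈ 𝓝 (l t) := Metric.ball_mem_nhds _ Real.pi_pos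
    filter_upwards [(hl t ht).eventually hball, self_mem_nhdsWithin] with s hs hsI
    have him : |(l s - l t).im| < Real.pi :=
      (abs_im_le_norm _).trans_lt (by rw [← dist_eq_norm]; exact hs)
    rw [abs_lt] at him
    rw [← hle s hsI, ← hle t ht, ← exp_sub, log_exp him.1 him.2.le, sub_add_cancel]

/-! ### Cauchy's formula for polynomials in an endomorphism -/

section
variable {E : Type*} [AddCommGroup E] [Module ℂ E] {γ : ℝ → ℂ}

theorem stieltjesSum_zero (γ : ℝ → ℂ) : stieltjesSum γ (fun _ => (0 : E)) = fun _ => 0 := by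
  ext N
  simp [stieltjesSum]

theorem stieltjesSum_smul_const (γ : ℝ → ℂ) (f : ℂ → ℂ) (v : E) (N : ℕ) :
    stieltjesSum γ (fun z => f z • v) N = stieltjesSum γ f N • v := by
  simp only [stieltjesSum, Finset.sum_smul, smul_smul, smul_eq_mul]

theorem stieltjesSum_const_smul (γ : ℝ → ℂ) (c : ℂ) (f : ℂ → E) (N : ℕ) :
    stieltjesSum γ (fun z => c • f z) N = c • stieltjesSum γ f N := by
  simp only [stieltjesSum, Finset.smul_sum, smul_comm c]

theorem stieltjesSum_add (γ : ℝ → ℂ) (f g : ℂ → E) (N : ℕ) :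
    stieltjesSum γ (fun z => f z + g z) N = stieltjesSum γ f N + stieltjesSum γ g N := by
  simp only [stieltjesSum, smul_add, Finset.sum_add_distrib]

theorem stieltjesSum_congr {f g : ℂ → E} (h : ∀ t ∈ Icc (0 : ℝ) 1, f (γ t) = g (γ t)) :
    stieltjesSum γ f = stieltjesSum γ g := by
  ext N
  refine Finset.sum_congr rfl fun i hi => ?_
  rw [h _ (natCast_div_mem_Icc (Finset.mem_range.1 hi).le)]

end

theorem tendsto_stieltjesSum_inv_pow {γ : ℝ → ℂ} (hc : ContinuousOn γ (Icc 0 1))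
    (hγ : eVariationOn γ (Icc 0 1) ≠ ⊤) (h01 : γ 0 = γ 1) {a : ℂ}
    (ha : ∀ t ∈ Icc (0 : ℝ) 1, γ t - a ≠ 0) {i : ℕ} (hi : i ≠ 0) :
    Tendsto (stieltjesSum γ fun z => ((z - a) ^ (i + 1))⁻¹) atTop (𝓝 0) := by
  refine tendsto_stieltjesSum_of_primitive hc hγ h01
    (F := fun z => (-(i : ℂ))⁻¹ * (z - a) ^ (-(i : ℤ))) (fun t ht => ?_) fun t ht =>
    ((continuousAt_id.sub continuousAt_const).pow _).inv₀ (pow_ne_zero _ (ha t ht))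
  have h1 := (HasStrictDerivAt.comp (γ t) (hasStrictDerivAt_zpow (-(i : ℤ)) (γ t - a)
    (Or.inl (ha t ht))) ((hasStrictDerivAt_id _).sub_const a)).const_mul (-(i : ℂ))⁻¹
  refine h1.congr_deriv ?_
  have hi' : (i : ℂ) ≠ 0 := by exact_mod_cast hi
  rw [show -(i : ℤ) - 1 = -((i + 1 : ℕ) : ℤ) by push_cast; ring, zpow_neg, zpow_natCast]
  push_cast
  field_simp

theorem tendsto_stieltjesSum_pow {γ : ℝ → ℂ} (hc : ContinuousOn γ (Icc 0 1))
    (hγ : eVariationOn γ (Icc 0 1) ≠ ⊤) (h01 : γ 0 = γ 1) (k : ℕ) :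
    Tendsto (stieltjesSum γ fun z => z ^ k) atTop (𝓝 0) := by
  refine tendsto_stieltjesSum_of_primitive hc hγ h01
    (F := fun z => ((k + 1 : ℕ) : ℂ)⁻¹ * z ^ (k + 1)) (fun t _ => ?_)
    fun t _ => (continuous_pow k).continuousAt
  refine ((hasStrictDerivAt_pow (k + 1) (γ t)).const_mul ((k + 1 : ℕ) : ℂ)⁻¹).congr_deriv ?_
  have : ((k + 1 : ℕ) : ℂ) ≠ 0 := Nat.cast_ne_zero.2 (Nat.succ_ne_zero k)
  rw [Nat.add_sub_cancel]
  field_simp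

section
variable {E : Type*} [NormedAddCommGroup E] [NormedSpace ℂ E] {γ : ℝ → ℂ} {L : Module.End ℂ E}
  {R : ℂ → Module.End ℂ E} {a : ℂ} {n : ℤ}

/-- Induction on the nilpotency order `d`, using `R(z) v = (z - a)⁻¹ v + (z - a)⁻¹ R(z) (L - a) v`.
Each use raises the power of `(z - a)⁻¹`, hence the general `i`; only the first power has a nonzero
integral. -/
theorem tendsto_stieltjesSum_resolvent (hc : ContinuousOn γ (Icc 0 1))
    (hγ : eVariationOn γ (Icc 0 1) ≠ ⊤) (h01 : γ 0 = γ 1) (hn : HasWindingNumber γ a n)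
    (hR : ∀ t ∈ Icc (0 : ℝ) 1, ∀ v, R (γ t) (γ t • v - L v) = v) (d : ℕ) (v : E)
    (hv : ((L - a • 1) ^ d) v = 0) (i : ℕ) :
    Tendsto (stieltjesSum γ fun z => ((z - a) ^ i)⁻¹ • R z v) atTop
      (𝓝 ((if i = 0 then n * (2 * Real.pi * I) else 0 : ℂ) • v)) := by
  have hne : ∀ t ∈ Icc (0 : ℝ) 1, γ t - a ≠ 0 := fun t ht => by
    obtain ⟨l, -, hle, -⟩ := hn
    rw [← hle t ht]; exact exp_ne_zero _
  induction d generalizing v i with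
  | zero =>
    have hv0 : v = 0 := by simpa using hv
    simp [hv0, stieltjesSum_zero]
  | succ d ih =>
    have ih' := ih ((L - a • 1) v) (by rwa [pow_succ] at hv) (i + 1)
    rw [if_neg (Nat.succ_ne_zero i), zero_smul] at ih'
    have hfirst : Tendsto (stieltjesSum γ fun z => ((z - a) ^ (i + 1))⁻¹) atTop
        (𝓝 (if i = 0 then n * (2 * Real.pi * I) else 0)) := by
      split_ifs with hi
      · subst hi
        simpa using hn.tendsto_stieltjesSum hc hγ
      · exact tendsto_stieltjesSum_inv_pow hc hγ h01 hne hi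
    have key : stieltjesSum γ (fun z => ((z - a) ^ i)⁻¹ • R z v) = fun N =>
        stieltjesSum γ (fun z => ((z - a) ^ (i + 1))⁻¹) N • v +
          stieltjesSum γ (fun z => ((z - a) ^ (i + 1))⁻¹ • R z ((L - a • 1) v)) N := by
      ext N
      rw [← stieltjesSum_smul_const, ← stieltjesSum_add]
      refine congrFun (stieltjesSum_congr fun t ht => ?_) N
      have h1 : (L - a • 1) v = (γ t - a) • v - (γ t • v - L v) := by
        simp only [LinearMap.sub_apply, LinearMap.smul_apply, Module.End.one_apply, sub_smul]
        abel
      rw [h1, map_sub, hR t ht, map_smul, smul_sub, smul_smul, pow_succ, mul_inv,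
        mul_assoc, inv_mul_cancel₀ (hne t ht), mul_one]
      abel
    rw [key]
    simpa using (hfirst.smul_const v).add ih'

/-- Since `z R(z) v = v + R(z) L v`, a factor `z` can be traded for `L`; the remaining `z ^ k v`
integrates to zero over a closed curve. -/
theorem tendsto_stieltjesSum_pow_smul_resolvent (hc : ContinuousOn γ (Icc 0 1))
    (hγ : eVariationOn γ (Icc 0 1) ≠ ⊤) (h01 : γ 0 = γ 1) (hn : HasWindingNumber γ a n)
    (hR : ∀ t ∈ Icc (0 : ℝ) 1, ∀ v, R (γ t) (γ t • v - L v) = v) (d : ℕ) (k : ℕ) (v : E)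
    (hv : ((L - a • 1) ^ d) v = 0) :
    Tendsto (stieltjesSum γ fun z => z ^ k • R z v) atTop
      (𝓝 ((n * (2 * Real.pi * I) : ℂ) • (L ^ k) v)) := by
  induction k generalizing v with
  | zero => simpa using tendsto_stieltjesSum_resolvent hc hγ h01 hn hR d v hv 0
  | succ k ih =>
    have hcomm : Commute ((L - a • 1) ^ d) L :=
      ((Commute.refl L).sub_left ((Commute.one_left L).smul_left a)).pow_left d
    have hLv : ((L - a • 1) ^ d) (L v) = 0 := by
      rw [← Module.End.mul_apply, hcomm.eq, Module.End.mul_apply, hv, map_zero]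
    have key : stieltjesSum γ (fun z => z ^ (k + 1) • R z v) = fun N =>
        stieltjesSum γ (fun z => z ^ k) N • v +
          stieltjesSum γ (fun z => z ^ k • R z (L v)) N := by
      ext N
      rw [← stieltjesSum_smul_const, ← stieltjesSum_add]
      refine congrFun (stieltjesSum_congr fun t ht => ?_) N
      have h1 : R (γ t) (L v) = γ t • R (γ t) v - v := by
        have := hR t ht v
        rw [map_sub, map_smul] at this
        exact eq_sub_of_add_eq (sub_eq_iff_eq_add'.1 this).symm
      rw [h1, smul_sub, smul_smul, ← pow_succ]
      abel
    rw [key, pow_succ, Module.End.mul_apply]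
    simpa using ((tendsto_stieltjesSum_pow hc hγ h01 k).smul_const v).add (ih (L v) hLv)

theorem tendsto_stieltjesSum_polynomial_smul_resolvent (hc : ContinuousOn γ (Icc 0 1))
    (hγ : eVariationOn γ (Icc 0 1) ≠ ⊤) (h01 : γ 0 = γ 1) (hn : HasWindingNumber γ a n)
    (hR : ∀ t ∈ Icc (0 : ℝ) 1, ∀ v, R (γ t) (γ t • v - L v) = v) (p : Polynomial ℂ) (d : ℕ)
    (v : E) (hv : ((L - a • 1) ^ d) v = 0) :
    Tendsto (stieltjesSum γ fun z => p.eval z • R z v) atTop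
      (𝓝 ((n * (2 * Real.pi * I) : ℂ) • (Polynomial.aeval L p) v)) := by
  induction p using Polynomial.induction_on' with
  | add p q hp hq =>
    simp only [Polynomial.eval_add, add_smul, map_add, LinearMap.add_apply, smul_add]
    exact (hp.add hq).congr fun N => (stieltjesSum_add _ _ _ N).symm
  | monomial k c =>
    have := (tendsto_stieltjesSum_pow_smul_resolvent hc hγ h01 hn hR d k v hv).const_smul c
    rw [Polynomial.aeval_monomial, Module.End.mul_apply, Module.algebraMap_end_apply, smul_comm]
    refine this.congr fun N => ?_
    simp only [Polynomial.eval_monomial, mul_smul]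
    exact (stieltjesSum_const_smul _ _ _ N).symm

end

namespace JordanCurve

theorem norm_eval_le_maxAbs (Γ : JordanCurve) (p : Polynomial ℂ) {z : ℂ} (hz : z ∈ Γ.trace) :
    ‖p.eval z‖ ≤ Γ.maxAbs p :=
  (Γ.isGreatest_maxAbs p).2 ⟨z, hz, rfl⟩

theorem maxAbs_nonneg (Γ : JordanCurve) (p : Polynomial ℂ) : 0 ≤ Γ.maxAbs p :=
  (norm_nonneg _).trans (Γ.norm_eval_le_maxAbs p (Γ.mem_trace (left_mem_Icc.2 zero_le_one)))

end JordanCurve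

theorem norm_aeval_apply_le {E : Type*} [NormedAddCommGroup E] [NormedSpace ℂ E]
    [FiniteDimensional ℂ E] {m : ℕ} (L : Module.End ℂ E) (Γ : Fin m → JordanCurve)
    (hΓ : ∀ j, (Γ j).Rectifiable) (ε : Fin m → ℝ) (hε : ∀ j, 0 < ε j)
    (hL : ∀ μ, L.HasEigenvalue μ →
      ∃ i, μ ∈ (Γ i).interior ∧ ∀ j, j ≠ i → μ ∈ (Γ j).exterior)
    (R : ℂ → Module.End ℂ E) (hR : ∀ j, ∀ z ∈ (Γ j).trace, ∀ v, R z (z • v - L v) = v)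
    (hRε : ∀ j, ∀ z ∈ (Γ j).trace, ∀ v, ‖R z v‖ ≤ 1 / ε j * ‖v‖) (p : Polynomial ℂ) (v : E) :
    ‖Polynomial.aeval L p v‖ ≤
      (∑ j, (Γ j).length.toReal / (2 * Real.pi * ε j) * (Γ j).maxAbs p) * ‖v‖ := by
  choose w hw0 hw using fun j => (Γ j).exists_windingNumber_interior
  have hcauchy : ∀ v : E, Tendsto (fun N => ∑ j, ((w j : ℂ) * (2 * Real.pi * I))⁻¹ •
      stieltjesSum (Γ j).toFun (fun z => p.eval z • R z v) N) atTop
      (𝓝 (Polynomial.aeval L p v)) := by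
    intro v
    -- Both sides are additive in `v`, and generalized eigenvectors span. On one for `μ`, only the
    -- curve around `μ` contributes.
    have hv : v ∈ ⨆ μ, L.maxGenEigenspace μ := by
      rw [Module.End.iSup_maxGenEigenspace_eq_top]; trivial
    induction hv using Submodule.iSup_induction' with
    | mem μ v hv =>
      rcases eq_or_ne v 0 with rfl | hv0
      · simp [stieltjesSum_zero]
      obtain ⟨d, hd⟩ := (Module.End.mem_maxGenEigenspace L μ v).1 hv
      have hμ : L.HasEigenvalue μ := by
        refine Module.End.hasEigenvalue_of_hasGenEigenvalue (k := d) ?_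
        intro hbot
        refine hv0 ((Submodule.mem_bot ℂ).1 (hbot ▸ ?_))
        exact Module.End.mem_genEigenspace_nat.2 hd
      obtain ⟨i, hi, hie⟩ := hL μ hμ
      have hlim : ∀ j, Tendsto (fun N => ((w j : ℂ) * (2 * Real.pi * I))⁻¹ •
          stieltjesSum (Γ j).toFun (fun z => p.eval z • R z v) N) atTop
          (𝓝 (if j = i then Polynomial.aeval L p v else 0)) := fun j => by
        have hgen := fun k (hk : HasWindingNumber (Γ j).toFun μ k) =>
          (tendsto_stieltjesSum_polynomial_smul_resolvent (Γ j).continuousOn' (hΓ j)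
            (Γ j).closed' hk (fun t ht => hR j _ ((Γ j).mem_trace ht)) p d v hd).const_smul
              ((w j : ℂ) * (2 * Real.pi * I))⁻¹
        split_ifs with hj
        · subst hj
          have := hgen _ (hw j μ hi)
          rwa [inv_smul_smul₀ (mul_ne_zero (Int.cast_ne_zero.2 (hw0 j)) two_pi_I_ne_zero)] at this
        · simpa using hgen 0 ((Γ j).hasWindingNumber_of_mem_exterior (hie j hj))
      simpa using tendsto_finsetSum Finset.univ fun j _ => hlim j
    | zero => simp [stieltjesSum_zero]
    | add x y _ _ hx hy =>
      rw [map_add]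
      refine (hx.add hy).congr fun N => ?_
      simp only [map_add, smul_add, stieltjesSum_add, Finset.sum_add_distrib]
  refine le_of_tendsto (hcauchy v).norm (Eventually.of_forall fun N => ?_)
  refine (norm_sum_le _ _).trans ?_
  rw [Finset.sum_mul]
  refine Finset.sum_le_sum fun j _ => ?_
  have hM := (Γ j).maxAbs_nonneg p
  have hbound : ‖stieltjesSum (Γ j).toFun (fun z => p.eval z • R z v) N‖ ≤
      (Γ j).length.toReal * ((Γ j).maxAbs p * (1 / ε j * ‖v‖)) := by
    have := hε j
    refine norm_stieltjesSum_le (hΓ j) (by positivity) (fun t ht => ?_) N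
    rw [norm_smul]
    exact mul_le_mul ((Γ j).norm_eval_le_maxAbs p ((Γ j).mem_trace ht))
      (hRε j _ ((Γ j).mem_trace ht) v) (norm_nonneg _) hM
  have hw1 : (1 : ℝ) ≤ ‖(w j : ℂ)‖ := by
    rw [norm_intCast]
    exact_mod_cast Int.one_le_abs (hw0 j)
  have hinv : ‖((w j : ℂ) * (2 * Real.pi * I))⁻¹‖ ≤ (2 * Real.pi)⁻¹ := by
    rw [norm_inv, norm_mul]
    have : ‖(2 * Real.pi * I : ℂ)‖ = 2 * Real.pi := by
      simp [abs_of_pos Real.pi_pos]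
    rw [this]
    refine inv_anti₀ (by positivity) (le_mul_of_one_le_left (by positivity) hw1)
  rw [norm_smul]
  calc _ ≤ (2 * Real.pi)⁻¹ * ((Γ j).length.toReal * ((Γ j).maxAbs p * (1 / ε j * ‖v‖))) :=
        mul_le_mul hinv hbound (norm_nonneg _) (by positivity)
    _ = _ := by
        have := (hε j).ne'
        field_simp

/-! ### The minimum over the residual polynomials -/

namespace JordanCurve

theorem length_toReal_pos {Γ : JordanCurve} (hΓ : Γ.Rectifiable) : 0 < Γ.length.toReal := by
  refine ENNReal.toReal_pos (fun h => ?_) hΓ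
  have h0 : (0 : ℝ) ∈ Icc (0 : ℝ) 1 := by simp
  have h2 : (1 / 2 : ℝ) ∈ Icc (0 : ℝ) 1 := by constructor <;> norm_num
  have hle := eVariationOn.edist_le Γ.toFun h0 h2
  rw [show eVariationOn Γ.toFun (Icc 0 1) = 0 from h, nonpos_iff_eq_zero, edist_eq_zero] at hle
  have := Γ.injOn' (by simp) (by constructor <;> norm_num) hle
  norm_num at this

theorem exists_injective_nodes (Γ : JordanCurve) (k : ℕ) :
    ∃ z : Fin (k + 1) → ℂ, Function.Injective z ∧ ∀ i, z i ∈ Γ.trace := by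
  have hmem : ∀ i : Fin (k + 1), ((i : ℕ) / (k + 1 : ℕ) : ℝ) ∈ Ico (0 : ℝ) 1 := fun i =>
    ⟨by positivity, (div_lt_one (by positivity)).2 (Nat.cast_lt.2 i.2)⟩
  refine ⟨fun i => Γ.toFun ((i : ℕ) / (k + 1 : ℕ)), fun i j hij => ?_,
    fun i => Γ.mem_trace (Ico_subset_Icc_self (hmem i))⟩
  have := Γ.injOn' (hmem i) (hmem j) hij
  rw [div_left_inj' (by positivity)] at this
  exact Fin.ext (Nat.cast_injective this)

theorem continuous_maxAbs_interpolate (Γ : JordanCurve) {k : ℕ} (z : Fin k → ℂ) :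
    Continuous fun v : Fin k → ℂ => Γ.maxAbs (Lagrange.interpolate Finset.univ z v) := by
  refine Γ.isCompact_trace.continuous_sSup ?_
  simp only [Function.HasUncurry.uncurry, id, Lagrange.interpolate_apply,
    Polynomial.eval_finsetSum, Polynomial.eval_mul, Polynomial.eval_C]
  fun_prop

end JordanCurve

/-- The values at `k + 1` distinct nodes on `Γ i` are coordinates for the polynomials of degree at
most `k`. The term of index `i` dominates `c i` times the sup norm of these values, which gives
coercivity. -/
theorem exists_isLeast_residualPolynomials {m : ℕ} (Γ : Fin m → JordanCurve) {c : Fin m → ℝ}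
    (hc : ∀ j, 0 < c j) (i : Fin m) (k : ℕ) :
    ∃ M : ℝ, IsLeast ((fun p : Polynomial ℂ => ∑ j, c j * (Γ j).maxAbs p) ''
      residualPolynomials k) M := by
  obtain ⟨z, hz, hzΓ⟩ := (Γ i).exists_injective_nodes k
  set P := Lagrange.interpolate (F := ℂ) Finset.univ z
  set Φ : Polynomial ℂ → ℝ := fun p => ∑ j, c j * (Γ j).maxAbs p
  have hdeg : ∀ p : Polynomial ℂ, p.natDegree ≤ k ↔
      p.degree < ((Finset.univ : Finset (Fin (k + 1))).card : ℕ) := fun p => by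
    rw [Finset.card_univ, Fintype.card_fin, Polynomial.degree_lt_iff_coeff_zero,
      Polynomial.natDegree_le_iff_coeff_eq_zero]
    rfl
  have hPeq : ∀ p : Polynomial ℂ, p.natDegree ≤ k → P (fun l => p.eval (z l)) = p := fun p hp =>
    (Lagrange.eq_interpolate hz.injOn ((hdeg p).1 hp)).symm
  have hPdeg : ∀ v, (P v).natDegree ≤ k := fun v =>
    (hdeg _).2 (Lagrange.degree_interpolate_lt _ hz.injOn)
  have hΦ : Continuous fun v => Φ (P v) := continuous_finsetSum _ fun j _ =>
    continuous_const.mul ((Γ j).continuous_maxAbs_interpolate z)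
  have hS : IsClosed {v | (P v).eval 0 = 1} := by
    refine isClosed_eq ?_ continuous_const
    simp only [P, Lagrange.interpolate_apply, Polynomial.eval_finsetSum, Polynomial.eval_mul,
      Polynomial.eval_C]
    fun_prop
  have hΦge : ∀ v, c i * ‖v‖ ≤ Φ (P v) := fun v => by
    have h1 : ‖v‖ ≤ (Γ i).maxAbs (P v) := by
      refine (pi_norm_le_iff_of_nonneg ((Γ i).maxAbs_nonneg _)).2 fun l => ?_
      rw [← Lagrange.eval_interpolate_at_node v hz.injOn (Finset.mem_univ l)]
      exact (Γ i).norm_eval_le_maxAbs _ (hzΓ l)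
    exact (mul_le_mul_of_nonneg_left h1 (hc i).le).trans
      (Finset.single_le_sum (f := fun j => c j * (Γ j).maxAbs (P v))
        (fun j _ => mul_nonneg (hc j).le ((Γ j).maxAbs_nonneg _)) (Finset.mem_univ i))
  have hv₀ : (fun l => (1 : Polynomial ℂ).eval (z l)) ∈ {v | (P v).eval 0 = 1} := by
    rw [mem_ofPred_eq, hPeq 1 (by simp), Polynomial.eval_one]
  -- Where `‖v‖` is at least `Φ 1 / c i`, the objective is no smaller than at the admissible
  -- polynomial `1`.
  obtain ⟨v, hv, hmin⟩ := hΦ.continuousOn.exists_isMinOn' hS hv₀ (by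
    refine Eventually.filter_mono inf_le_left ?_
    filter_upwards [(tendsto_norm_cocompact_atTop (E := Fin (k + 1) → ℂ)).eventually_ge_atTop
      (Φ (P fun l => (1 : Polynomial ℂ).eval (z l)) / c i)] with v hv
    rw [div_le_iff₀' (hc i)] at hv
    exact hv.trans (hΦge v))
  refine ⟨Φ (P v), ⟨P v, ⟨hPdeg v, hv⟩, rfl⟩, ?_⟩
  rintro _ ⟨p, hp, rfl⟩
  have hpS : (fun l => p.eval (z l)) ∈ {v | (P v).eval 0 = 1} := by
    rw [mem_ofPred_eq, hPeq p hp.1]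
    exact hp.2
  have := isMinOn_iff.1 hmin _ hpS
  rwa [hPeq p hp.1] at this

/-! ### GMRES -/

section
variable {n : ℕ} (A : Matrix (Fin n) (Fin n) ℂ)

theorem toEuclideanCLM_pow_apply (i : ℕ) (v : EuclideanSpace ℂ (Fin n)) :
    Matrix.toEuclideanCLM (𝕜 := ℂ) (A ^ i) v =
      ((Matrix.toEuclideanCLM (𝕜 := ℂ) A : Module.End ℂ (EuclideanSpace ℂ (Fin n))) ^ i) v := by
  induction i generalizing v with
  | zero => simp
  | succ i ih => rw [pow_succ, map_mul, pow_succ, Module.End.mul_apply, ← ih]; rfl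

theorem aeval_divX_mem_krylov {p : Polynomial ℂ} {k : ℕ} (hp : p.natDegree ≤ k)
    (v : EuclideanSpace ℂ (Fin n)) :
    Polynomial.aeval (Matrix.toEuclideanCLM (𝕜 := ℂ) A :
      Module.End ℂ (EuclideanSpace ℂ (Fin n))) p.divX v ∈ krylov A v k := by
  rcases Nat.eq_zero_or_pos k with rfl | hk
  · rw [Polynomial.eq_C_of_natDegree_le_zero hp, Polynomial.divX_C]
    simp
  · have hq : p.divX.natDegree < k := by
      rw [Polynomial.natDegree_divX_eq_natDegree_tsub_one]
      omega
    rw [Polynomial.aeval_eq_sum_range' hq, LinearMap.sum_apply]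
    refine Submodule.sum_mem _ fun i hi => ?_
    rw [LinearMap.smul_apply, ← toEuclideanCLM_pow_apply]
    exact Submodule.smul_mem _ _ (Submodule.subset_span ⟨⟨i, Finset.mem_range.1 hi⟩, rfl⟩)

variable {A}

/-- With `q = (p - 1) / X`, which is `p.divX`, `p(A) r₀ = r₀ + A q(A) r₀` is the residual of `x₀ -
q(A) r₀`. -/
theorem IsGMRES.norm_gmresResidual_le {b : EuclideanSpace ℂ (Fin n)}
    {x : ℕ → EuclideanSpace ℂ (Fin n)} (hx : IsGMRES A b x) {k : ℕ} {p : Polynomial ℂ}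
    (hp : p ∈ residualPolynomials k) :
    ‖gmresResidual A b (x k)‖ ≤ ‖Polynomial.aeval (Matrix.toEuclideanCLM (𝕜 := ℂ) A :
      Module.End ℂ (EuclideanSpace ℂ (Fin n))) p (gmresResidual A b (x 0))‖ := by
  set L := (Matrix.toEuclideanCLM (𝕜 := ℂ) A : Module.End ℂ (EuclideanSpace ℂ (Fin n)))
  set r := gmresResidual A b (x 0) with hr
  refine ((hx k).2 (x 0 - Polynomial.aeval L p.divX r) ?_).trans (le_of_eq ?_)
  · rw [sub_sub_cancel_left]
    exact Submodule.neg_mem _ (aeval_divX_mem_krylov A hp.1 r)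
  · have hp0 : p.coeff 0 = 1 := by
      rw [Polynomial.coeff_zero_eq_eval_zero]
      exact hp.2
    have hpX : Polynomial.aeval L p r = L (Polynomial.aeval L p.divX r) + r := by
      conv_lhs => rw [← p.X_mul_divX_add, hp0]
      simp
    rw [hpX, gmresResidual, map_sub, hr, gmresResidual]
    congr 1
    change _ = Matrix.toEuclideanCLM (𝕜 := ℂ) A _ + _
    abel

theorem toEuclideanCLM_inv_apply_smul_sub {z : ℂ} (hz : z ∉ spectrum ℂ A)
    (v : EuclideanSpace ℂ (Fin n)) :
    Matrix.toEuclideanCLM (𝕜 := ℂ) (z • (1 : Matrix (Fin n) (Fin n) ℂ) - A)⁻¹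
      (z • v - Matrix.toEuclideanCLM (𝕜 := ℂ) A v) = v := by
  have hu : IsUnit (z • (1 : Matrix (Fin n) (Fin n) ℂ) - A) := by
    rw [← Algebra.algebraMap_eq_smul_one]
    exact spectrum.notMem_iff.1 hz
  have h1 : z • v - Matrix.toEuclideanCLM (𝕜 := ℂ) A v =
      Matrix.toEuclideanCLM (𝕜 := ℂ) (z • (1 : Matrix (Fin n) (Fin n) ℂ) - A) v := by
    simp
  rw [h1, ← mul_apply_eq_comp, ← map_mul,
    Matrix.nonsing_inv_mul _ ((Matrix.isUnit_iff_isUnit_det _).1 hu), map_one,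
    one_apply_eq_self]

theorem mem_spectrum_of_hasEigenvalue {μ : ℂ}
    (h : Module.End.HasEigenvalue (Matrix.toEuclideanCLM (𝕜 := ℂ) A :
      Module.End ℂ (EuclideanSpace ℂ (Fin n))) μ) : μ ∈ spectrum ℂ A := by
  by_contra hμ
  obtain ⟨v, hv⟩ := h.exists_hasEigenvector
  refine hv.2 ?_
  have h1 : Matrix.toEuclideanCLM (𝕜 := ℂ) A v = μ • v := hv.apply_eq_smul
  have h2 := toEuclideanCLM_inv_apply_smul_sub hμ v
  rwa [h1, sub_self, map_zero, eq_comm] at h2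

end

end GmresBound

theorem mainTheorem6 {n m : ℕ} (A : Matrix (Fin n) (Fin n) ℂ)
    (b : EuclideanSpace ℂ (Fin n)) (x : ℕ → EuclideanSpace ℂ (Fin n))
    (hx : IsGMRES A b x) (hr₀ : gmresResidual A b (x 0) ≠ 0)
    (Λ : Fin m → Set ℂ) (hΛ_disj : Pairwise fun i j => Disjoint (Λ i) (Λ j))
    (hΛ_union : ⋃ j, Λ j = spectrum ℂ A)
    (Γ : Fin m → JordanCurve) (hΓ_rect : ∀ j, (Γ j).Rectifiable)
    (hΓ_disj : Pairwise fun i j => Disjoint (Γ i).trace (Γ j).trace)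
    (ε : Fin m → ℝ) (hε : ∀ j, 0 < ε j)
    (h_int : ∀ j, Λ j ⊆ (Γ j).interior)
    (h_ext : ∀ j, spectrum ℂ A \ Λ j ⊆ (Γ j).exterior)
    (h_res : ∀ j, ∀ z ∈ (Γ j).trace,
      ‖(z • (1 : Matrix (Fin n) (Fin n) ℂ) - A)⁻¹‖ ≤ 1 / ε j)
    (k : ℕ) :
    ∃ M : ℝ,
      IsLeast ((fun p : Polynomial ℂ =>
        ∑ j, (Γ j).length.toReal / (2 * Real.pi * ε j) * (Γ j).maxAbs p) ''
          residualPolynomials k) M ∧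
      ‖gmresResidual A b (x k)‖ / ‖gmresResidual A b (x 0)‖ ≤ M := by
  set L := (Matrix.toEuclideanCLM (𝕜 := ℂ) A : Module.End ℂ (EuclideanSpace ℂ (Fin n)))
  have hL : ∀ μ, Module.End.HasEigenvalue L μ →
      ∃ i, μ ∈ (Γ i).interior ∧ ∀ j, j ≠ i → μ ∈ (Γ j).exterior := fun μ hμ => by
    have hmem := mem_spectrum_of_hasEigenvalue hμ
    obtain ⟨i, hi⟩ := Set.mem_iUnion.1 (hΛ_union.symm ▸ hmem)
    exact ⟨i, h_int i hi, fun j hj => h_ext j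
      ⟨hmem, fun hj' => Set.disjoint_left.1 (hΛ_disj hj) hj' hi⟩⟩
  -- The matrix inverse of a singular matrix is `0` by default, so the resolvent bound alone would
  -- not keep eigenvalues off the curves.
  have hspec : ∀ j, ∀ z ∈ (Γ j).trace, z ∉ spectrum ℂ A := fun j z hz hmem => by
    by_cases hzΛ : z ∈ Λ j
    · exact (h_int j hzΛ).1 hz
    · exact (h_ext j ⟨hmem, hzΛ⟩).1 hz
  -- A nonzero `r₀` forces an eigenvalue, hence at least one curve, which coercivity requires.
  obtain ⟨i⟩ : Nonempty (Fin m) := by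
    have : Nontrivial (EuclideanSpace ℂ (Fin n)) := ⟨⟨_, _, hr₀⟩⟩
    obtain ⟨μ, hμ⟩ := Module.End.exists_eigenvalue L
    exact ⟨(hL μ hμ).choose⟩
  obtain ⟨M, hM⟩ := exists_isLeast_residualPolynomials Γ
    (c := fun j => (Γ j).length.toReal / (2 * Real.pi * ε j))
    (fun j => div_pos (JordanCurve.length_toReal_pos (hΓ_rect j))
      (mul_pos Real.two_pi_pos (hε j))) i k
  refine ⟨M, hM, ?_⟩
  obtain ⟨p, hp, rfl⟩ := hM.1
  rw [div_le_iff₀ (norm_pos_iff.2 hr₀)]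
  refine (hx.norm_gmresResidual_le hp).trans (norm_aeval_apply_le L Γ hΓ_rect ε hε hL
    (fun z => (Matrix.toEuclideanCLM (𝕜 := ℂ) (z • (1 : Matrix (Fin n) (Fin n) ℂ) - A)⁻¹ :
      Module.End ℂ (EuclideanSpace ℂ (Fin n)))) (fun j z hz v => ?_) (fun j z hz v => ?_) p _)
  · exact toEuclideanCLM_inv_apply_smul_sub (hspec j z hz) v
  · refine (ContinuousLinearMap.le_opNorm _ v).trans ?_
    exact mul_le_mul_of_nonneg_right (h_res j z hz) (norm_nonneg v)
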